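/- Let $G$ be a maximal outerplanar graph on at least three vertices, that is, a graph obtained from a cycle of length at least three by adding pairwise noncrossing chords so as to make it a triangulation. For a proper colouring of the vertices of $G$, a \emph{rainbow committee} is a set consisting of exactly one vertex of each colour used. The \emph{Connected-compelling chromatic number} of $G$ is the minimum number of colours in a proper colouring of $G$ for which every rainbow committee induces a connected subgraph of $G$. The \emph{connected domination number} $\gamma_c(G)$ is the minimum cardinality of a set $D$ of vertices that induces a connected subgraph and is such that every vertex outside $D$ has a neighbour in $D$. Then a colouring as above exists, and the Connected-compelling chromatic number of $G$ equals $\gamma_c(G)+2$. -/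

import Mathlib

namespace SimpleGraph

/-- `S` is a rainbow committee of the coloring `C`: it consists of exactly one vertex of each
color. -/
def Coloring.IsRainbowCommittee {V α : Type*} {G : SimpleGraph V} (C : G.Coloring α)
    (S : Set V) : Prop :=
  ∀ c : α, ∃! v : V, v ∈ S ∧ C v = c

/-- The proper coloring `C` compels the property `P` of vertex sets: every rainbow committee
has property `P`. -/
def Coloring.Compels {V α : Type*} {G : SimpleGraph V} (C : G.Coloring α)
    (P : Set V → Prop) : Prop :=
  ∀ S : Set V, C.IsRainbowCommittee S → P S

/-- `G` has a proper coloring with exactly `n` colors (each of them is used) that compels `P`. -/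
def HasCompellingColoring {V : Type*} (G : SimpleGraph V) (P : Set V → Prop) (n : ℕ) : Prop :=
  ∃ C : G.Coloring (Fin n), Function.Surjective C ∧ C.Compels P

/-- The `P`-compelling chromatic number: the least number of colors in a proper coloring that
compels `P`. It is `⊤` exactly when there is no such coloring with finitely many colors. -/
noncomputable def compellingChromaticNumber {V : Type*} (G : SimpleGraph V)
    (P : Set V → Prop) : ℕ∞ :=
  ⨅ n ∈ {n : ℕ | G.HasCompellingColoring P n}, (n : ℕ∞)

/-- The property "Connected" of a vertex set: it induces a (nonempty) connected subgraph. -/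
def InducesConnected {V : Type*} (G : SimpleGraph V) (S : Set V) : Prop :=
  (G.induce S).Connected

/-- `D` is a dominating set: every vertex outside `D` has a neighbor in `D`. -/
def IsDominating {V : Type*} (G : SimpleGraph V) (D : Set V) : Prop :=
  ∀ v : V, v ∉ D → ∃ u ∈ D, G.Adj v u

/-- The connected domination number: the least cardinality of a dominating set that induces a
connected subgraph (`⊤` if there is no finite one). -/
noncomputable def connectedDominationNumber {V : Type*} (G : SimpleGraph V) : ℕ∞ :=
  ⨅ D ∈ {D : Set V | G.IsDominating D ∧ G.InducesConnected D}, D.encard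

/-- The vertices `0, 1, …, n - 1` are placed on a circle in this order; no two edges, drawn as
straight segments, cross. -/
def IsNoncrossing {n : ℕ} (H : SimpleGraph (Fin n)) : Prop :=
  ∀ a b c d : Fin n, a < b → b < c → c < d → ¬ (H.Adj a c ∧ H.Adj b d)

/-- `T` is a triangulation of the convex `n`-gon with vertices `0, 1, …, n - 1`: the boundary
cycle together with a set of pairwise noncrossing chords to which no further chord can be added. -/
def IsPolygonTriangulation {n : ℕ} (T : SimpleGraph (Fin n)) : Prop :=
  Maximal (fun H : SimpleGraph (Fin n) => cycleGraph n ≤ H ∧ H.IsNoncrossing) T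

/-- Maximal outerplanar graph (MOP): a graph obtained from a cycle by adding noncrossing chords
to make it a triangulation. (The degenerate values `n = 1, 2` give the one-vertex graph and the
one-edge graph.) -/
def IsMOP {V : Type*} (G : SimpleGraph V) : Prop :=
  ∃ (n : ℕ) (T : SimpleGraph (Fin n)), T.IsPolygonTriangulation ∧ Nonempty (G ≃g T)

end SimpleGraph

/-!
Place the vertices of `G` on a polygon triangulated by `T`. Both inequalities rest on the triangles
of `T` and on the fact that an edge separates the two arcs it cuts off.

Upper bound: a connected dominating set `D` meets every triangle, since otherwise it would lie
beyond one side of a missed triangle and not dominate the opposite vertex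
(`IsNoncrossing.triangle_meets_of_dominating`). Hence the vertices outside `D` induce a bipartite
graph (`IsPolygonTriangulation.exists_bool_coloring`). Two colors for them, and one color for each
vertex of `D`, form a coloring whose committees all contain `D`, so that they are connected.

Lower bound: consider a coloring compelling connectivity, and let `D₀` be the set of vertices that
are alone in their color class. If both ends of a chord could be avoided by committees, some
committee would avoid both and have vertices on both sides of the chord. So `D₀` covers the chords
(`IsPolygonTriangulation.coversChords_of_compels`). A nonempty set covering the chords meets every
triangle and every chord, which makes it dominating and, as adjacent triangles share a chord,
connected (`CoversChords.isDominating`, `CoversChords.inducesConnected`). If at least two classes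
have several vertices, then `D₀` misses two colors. If exactly one class `A` has several vertices,
some vertex outside `A` has no chord to `A`
(`IsPolygonTriangulation.exists_notMem_forall_side`), and without it `D₀` still covers the chords.
If all classes are singletons, the complement of the two ends of a side covers the chords.
-/

namespace SimpleGraph

/-! ### Edges, triangles and separation in a triangulated polygon -/

section Polygon

variable {n : ℕ} {T : SimpleGraph (Fin n)}

/-- Two vertices `p < q` of the polygon are joined by a side exactly when they are consecutive or
are the first and the last one. -/
theorem cycleGraph_adj_iff_of_lt {p q : Fin n} (h : p < q) :
    (cycleGraph n).Adj p q ↔ (q : ℕ) = p + 1 ∨ ((p : ℕ) = 0 ∧ (q : ℕ) + 1 = n) := by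
  have h1 : ((q - p : Fin n) : ℕ) = q - p := Fin.coe_sub_iff_le.2 h.le
  have h2 : ((p - q : Fin n) : ℕ) = n + p - q := Fin.coe_sub_iff_lt.2 h
  rw [cycleGraph_adj', h1, h2]
  have := Fin.lt_def.1 h
  have := q.isLt
  omega

namespace IsPolygonTriangulation

theorem adj_of_val_eq_succ (hT : T.IsPolygonTriangulation) {p q : Fin n}
    (h : (q : ℕ) = p + 1) : T.Adj p q :=
  hT.prop.1 ((cycleGraph_adj_iff_of_lt (Fin.lt_def.2 (by omega))).2 (Or.inl h))

theorem adj_first_last (hT : T.IsPolygonTriangulation) {p q : Fin n} (hpq : p < q)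
    (hp : (p : ℕ) = 0) (hq : (q : ℕ) + 1 = n) : T.Adj p q :=
  hT.prop.1 ((cycleGraph_adj_iff_of_lt hpq).2 (Or.inr ⟨hp, hq⟩))

/-- Maximality of a triangulation: a missing chord is crossed by some edge. -/
theorem exists_crossing (hT : T.IsPolygonTriangulation) {p q : Fin n} (hpq : p < q)
    (h : ¬ T.Adj p q) : ∃ c d, T.Adj c d ∧ p < c ∧ c < q ∧ (d < p ∨ q < d) := by
  by_contra! hno
  have hnc : (T ⊔ edge p q).IsNoncrossing := by
    rintro a b c d hab hbc hcd ⟨hac, hbd⟩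
    rw [sup_adj, edge_adj] at hac hbd
    rcases hac with hac | ⟨⟨rfl, rfl⟩ | ⟨rfl, rfl⟩, -⟩
    · rcases hbd with hbd | ⟨⟨rfl, rfl⟩ | ⟨rfl, rfl⟩, -⟩
      · exact hT.prop.2 a b c d hab hbc hcd ⟨hac, hbd⟩
      · exact absurd hab (not_lt.2 (hno c a hac.symm hbc hcd).1)
      · exact absurd (hbc.trans hcd) hpq.asymm
    · rcases hbd with hbd | ⟨⟨rfl, rfl⟩ | ⟨rfl, rfl⟩, -⟩
      · exact absurd hcd (not_lt.2 (hno b d hbd hab hbc).2)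
      · exact absurd hab (lt_irrefl _)
      · exact absurd (hbc.trans hcd) hpq.asymm
    · exact absurd (hab.trans hbc) hpq.asymm
  refine h (hT.2 ⟨hT.prop.1.trans le_sup_left, hnc⟩ le_sup_left ?_)
  rw [sup_adj, edge_adj]
  exact Or.inr ⟨Or.inl ⟨rfl, rfl⟩, hpq.ne⟩

/-- Every edge `i j` with a vertex strictly between its ends is a side of a triangle whose third
vertex lies between them. -/
theorem exists_apex (hT : T.IsPolygonTriangulation) {i j : Fin n} (hij : T.Adj i j)
    (h : (i : ℕ) + 1 < j) : ∃ m, i < m ∧ m < j ∧ T.Adj i m ∧ T.Adj m j := by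
  -- The apex is the last neighbour of `i` before `j`.
  let s : Set (Fin n) := {m | i < m ∧ m < j ∧ T.Adj i m}
  have hs : s.Nonempty := by
    refine ⟨⟨i + 1, by omega⟩, Fin.lt_def.2 (by simp), Fin.lt_def.2 h, ?_⟩
    exact hT.adj_of_val_eq_succ rfl
  obtain ⟨m, ⟨him, hmj, hadj⟩, hmax⟩ := s.toFinite.exists_maximal hs
  refine ⟨m, him, hmj, hadj, ?_⟩
  by_contra hnadj
  obtain ⟨c, d, hcd, hmc, hcj, hd⟩ := hT.exists_crossing hmj hnadj
  have hic := him.trans hmc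
  rcases hd with hd | hd
  · rcases lt_trichotomy d i with hdi | rfl | hid
    · exact hT.prop.2 d i c j hdi hic hcj ⟨hcd.symm, hij⟩
    · exact absurd (hmax ⟨hic, hcj, hcd.symm⟩ hmc.le) (not_le.2 hmc)
    · exact hT.prop.2 i d m c hid hd hmc ⟨hadj, hcd.symm⟩
  · exact hT.prop.2 i c j d hic hcj hd ⟨hij, hcd⟩

end IsPolygonTriangulation

/-- An edge `p q` separates the vertices strictly between `p` and `q` from those outside: a
connected set avoiding `p` and `q` lies on one side. -/
theorem IsNoncrossing.between_of_inducesConnected (hT : T.IsNoncrossing) {p q : Fin n}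
    (hadj : T.Adj p q) {S : Set (Fin n)} (hS : T.InducesConnected S)
    (hp : p ∉ S) (hq : q ∉ S) {x y : Fin n} (hx : x ∈ S) (hy : y ∈ S) (hpx : p < x)
    (hxq : x < q) : p < y ∧ y < q := by
  obtain ⟨w⟩ := hS.preconnected ⟨x, hx⟩ ⟨y, hy⟩
  suffices ∀ (a b : S), (T.induce S).Walk a b → p < a.1 → a.1 < q → p < b.1 ∧ b.1 < q from
    this _ _ w hpx hxq
  intro a b w
  induction w with
  | nil => exact fun h1 h2 => ⟨h1, h2⟩
  | @cons u v t huv _ ih =>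
    intro h1 h2
    have huv' : T.Adj u.1 v.1 := huv
    have hvp : v.1 ≠ p := fun h => hp (h ▸ v.2)
    have hvq : v.1 ≠ q := fun h => hq (h ▸ v.2)
    refine ih ?_ ?_
    · by_contra hlt
      exact hT v.1 p u.1 q (lt_of_le_of_ne (not_lt.1 hlt) hvp) h1 h2 ⟨huv'.symm, hadj⟩
    · by_contra hlt
      exact hT p u.1 q v.1 h1 h2 (lt_of_le_of_ne (not_lt.1 hlt) hvq.symm) ⟨hadj, huv'⟩

/-! ### Sets that meet every chord -/

/-- `D` meets every chord of `T`, that is, every edge of `T` that is not a side of the polygon. -/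
def CoversChords (T : SimpleGraph (Fin n)) (D : Set (Fin n)) : Prop :=
  ∀ p q, T.Adj p q → ¬ (cycleGraph n).Adj p q → p ∈ D ∨ q ∈ D

/-- It suffices to check chords with their ends in increasing order. -/
theorem coversChords_of_lt {D : Set (Fin n)}
    (h : ∀ p q, p < q → T.Adj p q → ¬ (cycleGraph n).Adj p q → p ∈ D ∨ q ∈ D) :
    T.CoversChords D := by
  intro p q hadj hc
  rcases lt_or_gt_of_ne hadj.ne with hlt | hlt
  · exact h p q hlt hadj hc
  · exact (h q p hlt hadj.symm fun h => hc h.symm).symm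

theorem CoversChords.mem_or_mem {D : Set (Fin n)} (hD : T.CoversChords D) {p q : Fin n}
    (hadj : T.Adj p q) (h : (p : ℕ) + 1 < q) (h' : (p : ℕ) ≠ 0 ∨ (q : ℕ) + 1 ≠ n) :
    p ∈ D ∨ q ∈ D := by
  refine hD p q hadj ?_
  rw [cycleGraph_adj_iff_of_lt (Fin.lt_def.2 (by omega))]
  omega

/-- A triangle with no chord among its sides is the whole polygon. -/
theorem CoversChords.triangle_meets {D : Set (Fin n)} (hD : T.CoversChords D) (hne : D.Nonempty)
    {i m j : Fin n} (him : i < m) (hmj : m < j) (h1 : T.Adj i m) (h2 : T.Adj m j)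
    (h3 : T.Adj i j) : i ∈ D ∨ m ∈ D ∨ j ∈ D := by
  by_contra! hno
  obtain ⟨hi, hm, hj⟩ := hno
  obtain ⟨d, hd⟩ := hne
  have hdi : (d : ℕ) ≠ i := fun h => hi (Fin.ext h ▸ hd)
  have hdm : (d : ℕ) ≠ m := fun h => hm (Fin.ext h ▸ hd)
  have hdj : (d : ℕ) ≠ j := fun h => hj (Fin.ext h ▸ hd)
  have := d.isLt
  have := j.isLt
  rw [Fin.lt_def] at him hmj
  have e1 : (i : ℕ) + 1 = m := by
    by_contra
    exact (hD.mem_or_mem h1 (by omega) (by omega)).elim hi hm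
  have e2 : (m : ℕ) + 1 = j := by
    by_contra
    exact (hD.mem_or_mem h2 (by omega) (by omega)).elim hm hj
  have e3 : (i : ℕ) = 0 ∧ (j : ℕ) + 1 = n := by
    by_contra
    exact (hD.mem_or_mem h3 (by omega) (by omega)).elim hi hj
  omega

/-- Induction over the edges of a triangulation, seen as arcs `[i, j]`: an arc with more than two
vertices splits at the third vertex of the triangle on its inner side. -/
theorem IsPolygonTriangulation.arc_induction (hT : T.IsPolygonTriangulation)
    {P : Fin n → Fin n → Prop}
    (base : ∀ i j : Fin n, T.Adj i j → (j : ℕ) = i + 1 → P i j)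
    (step : ∀ i m j : Fin n, i < m → m < j → T.Adj i m → T.Adj m j → T.Adj i j →
      P i m → P m j → P i j)
    {i j : Fin n} (hij : i < j) (hadj : T.Adj i j) : P i j := by
  induction hk : (j : ℕ) - i using Nat.strong_induction_on generalizing i j with
  | _ k ih =>
    rw [Fin.lt_def] at hij
    by_cases h : (j : ℕ) = i + 1
    · exact base i j hadj h
    obtain ⟨m, him, hmj, h1, h2⟩ := hT.exists_apex hadj (by omega)
    have him' := Fin.lt_def.1 him
    have hmj' := Fin.lt_def.1 hmj
    exact step i m j him hmj h1 h2 hadj (ih _ (by omega) him h1 rfl) (ih _ (by omega) hmj h2 rfl)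

/-- Every vertex lies in a triangle, and every triangle meets a nonempty set covering the
chords. -/
theorem CoversChords.isDominating (hT : T.IsPolygonTriangulation) (hn : 3 ≤ n)
    {D : Set (Fin n)} (hD : T.CoversChords D) (hne : D.Nonempty) : T.IsDominating D := by
  have key : ∀ i j : Fin n, i < j → T.Adj i j → (i : ℕ) + 1 < j →
      ∀ v, i ≤ v → v ≤ j → v ∉ D → ∃ u ∈ D, T.Adj v u := by
    intro i j hij hadj
    refine hT.arc_induction (P := fun i j => (i : ℕ) + 1 < j →
      ∀ v, i ≤ v → v ≤ j → v ∉ D → ∃ u ∈ D, T.Adj v u) ?_ ?_ hij hadj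
    · intro i j _ h1 h2
      omega
    · intro i m j him hmj h1 h2 h3 ih1 ih2 _ v hiv hvj hv
      have htri := hD.triangle_meets hne him hmj h1 h2 h3
      by_cases hvi : v = i
      · subst hvi
        rcases htri with h | h | h
        exacts [absurd h hv, ⟨m, h, h1⟩, ⟨j, h, h3⟩]
      by_cases hvm : v = m
      · subst hvm
        rcases htri with h | h | h
        exacts [⟨i, h, h1.symm⟩, absurd h hv, ⟨j, h, h2⟩]
      by_cases hvj' : v = j
      · subst hvj'
        rcases htri with h | h | h
        exacts [⟨i, h, h3.symm⟩, ⟨m, h, h2.symm⟩, absurd h hv]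
      rw [Fin.ext_iff] at hvi hvm hvj'
      rw [Fin.le_def] at hiv hvj
      rcases le_total v m with hle | hle
      · have := Fin.le_def.1 hle
        exact ih1 (by omega) v (Fin.le_def.2 hiv) hle hv
      · have := Fin.le_def.1 hle
        exact ih2 (by omega) v hle (Fin.le_def.2 hvj) hv
  intro v hv
  have hlt : (⟨0, by omega⟩ : Fin n) < ⟨n - 1, by omega⟩ := Fin.lt_def.2 (by simp; omega)
  have hvlt := v.isLt
  exact key _ _ hlt (hT.adj_first_last hlt rfl (by simp; omega)) (by simp; omega) v
    (Fin.le_def.2 (by simp)) (Fin.le_def.2 (by simp; omega)) hv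

/-- Triangles sharing a chord share a vertex of `D`, so the parts of `D` in the triangles link
up. -/
theorem CoversChords.inducesConnected (hT : T.IsPolygonTriangulation) (hn : 3 ≤ n)
    {D : Set (Fin n)} (hD : T.CoversChords D) (hne : D.Nonempty) : T.InducesConnected D := by
  have hadjr : ∀ {a b : Fin n} (ha : a ∈ D) (hb : b ∈ D), T.Adj a b →
      (T.induce D).Reachable ⟨a, ha⟩ ⟨b, hb⟩ := fun ha hb h => Adj.reachable (by exact h)
  have key : ∀ i j : Fin n, i < j → T.Adj i j →
      ∀ a b, (ha : a ∈ D) → (hb : b ∈ D) → i ≤ a → a ≤ j → i ≤ b → b ≤ j →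
        (T.induce D).Reachable ⟨a, ha⟩ ⟨b, hb⟩ := by
    intro i j hij hadj
    refine hT.arc_induction (P := fun i j =>
      ∀ a b, (ha : a ∈ D) → (hb : b ∈ D) → i ≤ a → a ≤ j → i ≤ b → b ≤ j →
        (T.induce D).Reachable ⟨a, ha⟩ ⟨b, hb⟩) ?_ ?_ hij hadj
    · intro i j hadj hj a b ha hb h1 h2 h3 h4
      by_cases hab : a = b
      · subst hab; rfl
      refine hadjr ha hb ?_
      rw [Fin.le_def] at h1 h2 h3 h4
      rw [Fin.ext_iff] at hab
      rcases Nat.lt_or_ge a b with h | h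
      · exact hT.adj_of_val_eq_succ (by omega)
      · exact (hT.adj_of_val_eq_succ (by omega)).symm
    · intro i m j him hmj h1 h2 h3 ih1 ih2
      -- It suffices to link a vertex of the left subarc with one of the right subarc.
      have cross : ∀ a b, (ha : a ∈ D) → (hb : b ∈ D) → i ≤ a → a ≤ m → m ≤ b → b ≤ j →
          (T.induce D).Reachable ⟨a, ha⟩ ⟨b, hb⟩ := by
        intro a b ha hb hia ham hmb hbj
        by_cases hm : m ∈ D
        · exact (ih1 a m ha hm hia ham him.le le_rfl).trans
            (ih2 m b hm hb le_rfl hmj.le hmb hbj)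
        have ham' : a ≠ m := fun h => hm (h ▸ ha)
        have hbm' : b ≠ m := fun h => hm (h ▸ hb)
        rw [Fin.le_def] at hia ham hmb hbj
        rw [Ne, Fin.ext_iff] at ham' hbm'
        have him' := Fin.lt_def.1 him
        have hmj' := Fin.lt_def.1 hmj
        have hi : i ∈ D := by
          by_cases h : (m : ℕ) = i + 1
          · rwa [← Fin.ext (by omega : (a : ℕ) = i)]
          · exact (hD.mem_or_mem h1 (by omega) (by omega)).resolve_right hm
        have hj : j ∈ D := by
          by_cases h : (j : ℕ) = m + 1
          · rwa [← Fin.ext (by omega : (b : ℕ) = j)]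
          · exact (hD.mem_or_mem h2 (by omega) (by omega)).resolve_left hm
        exact ((ih1 a i ha hi hia ham le_rfl him.le).trans (hadjr hi hj h3)).trans
          (ih2 j b hj hb hmj.le le_rfl hmb hbj)
      intro a b ha hb hia haj hib hbj
      rcases le_total a m with ham | hma <;> rcases le_total b m with hbm | hmb
      · exact ih1 a b ha hb hia ham hib hbm
      · exact cross a b ha hb hia ham hmb hbj
      · exact (cross b a hb ha hib hbm hma haj).symm
      · exact ih2 a b ha hb hma haj hmb hbj
  have hlt : (⟨0, by omega⟩ : Fin n) < ⟨n - 1, by omega⟩ := Fin.lt_def.2 (by simp; omega)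
  have h0 : ∀ v : Fin n, (⟨0, by omega⟩ : Fin n) ≤ v := fun v => Fin.le_def.2 (by simp)
  have h1 : ∀ v : Fin n, v ≤ (⟨n - 1, by omega⟩ : Fin n) := fun v => by
    have := v.isLt
    exact Fin.le_def.2 (by simp; omega)
  have : Nonempty D := hne.to_subtype
  refine ⟨fun a b => ?_⟩
  exact key _ _ hlt (hT.adj_first_last hlt rfl (by simp; omega)) a b a.2 b.2
    (h0 _) (h1 _) (h0 _) (h1 _)

/-- All vertices but the two ends of one side form a connected dominating set. -/
theorem IsPolygonTriangulation.exists_connected_dominating_encard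
    (hT : T.IsPolygonTriangulation) (hn : 3 ≤ n) :
    ∃ D : Set (Fin n), T.IsDominating D ∧ T.InducesConnected D ∧ D.encard + 2 ≤ n := by
  let z : Fin n := ⟨0, by omega⟩
  let l : Fin n := ⟨n - 1, by omega⟩
  have hzl : z < l := Fin.lt_def.2 (by simp [z, l]; omega)
  have hside : (cycleGraph n).Adj z l :=
    (cycleGraph_adj_iff_of_lt hzl).2 (Or.inr ⟨rfl, by simp [l]; omega⟩)
  have hcov : T.CoversChords {z, l}ᶜ := by
    intro p q hadj hc
    by_contra! h
    simp only [Set.mem_compl_iff, not_not, Set.mem_insert_iff, Set.mem_singleton_iff] at h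
    obtain ⟨rfl | rfl, rfl | rfl⟩ := h
    exacts [hadj.ne rfl, hc hside, hc hside.symm, hadj.ne rfl]
  have hne : ({z, l}ᶜ : Set (Fin n)).Nonempty :=
    ⟨⟨1, by omega⟩, by simp [z, l, Fin.ext_iff]; omega⟩
  refine ⟨{z, l}ᶜ, hcov.isDominating hT hn hne, hcov.inducesConnected hT hn hne, ?_⟩
  have h := Set.encard_add_encard_compl ({z, l} : Set (Fin n))
  rw [Set.encard_pair hzl.ne, Set.encard_univ, ENat.card_eq_coe_fintype_card,
    Fintype.card_fin, add_comm] at h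
  exact h.le

end Polygon

/-! ### From connected dominating sets to colorings -/

/-- Adding dominated vertices to a connected dominating set keeps it connected. -/
theorem InducesConnected.superset {V : Type*} {G : SimpleGraph V} {D S : Set V}
    (hc : G.InducesConnected D) (hd : G.IsDominating D) (hDS : D ⊆ S) : G.InducesConnected S := by
  obtain ⟨⟨x, hx⟩⟩ := hc.nonempty
  have hD : ∀ (d : V) (h : d ∈ D), (G.induce S).Reachable ⟨d, hDS h⟩ ⟨x, hDS hx⟩ := fun d h =>
    (hc.preconnected ⟨d, h⟩ ⟨x, hx⟩).map (induceHomOfLE G hDS).toHom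
  have hS : ∀ s : S, (G.induce S).Reachable s ⟨x, hDS hx⟩ := by
    rintro ⟨s, hs⟩
    by_cases h : s ∈ D
    · exact hD s h
    · obtain ⟨u, hu, hadj⟩ := hd s h
      exact (Adj.reachable (G := G.induce S) (u := ⟨s, hs⟩) (v := ⟨u, hDS hu⟩) (by exact hadj)).trans
        (hD u hu)
  have : Nonempty S := ⟨⟨x, hDS hx⟩⟩
  exact ⟨fun a b => (hS a).trans (hS b).symm⟩

/-- The colors may come from any type with `n` elements. -/
theorem hasCompellingColoring_of_fintype {V α : Type*} [Fintype α] {G : SimpleGraph V}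
    {P : Set V → Prop} {n : ℕ} (hn : Fintype.card α = n) (C : G.Coloring α)
    (hC : Function.Surjective C) (hP : C.Compels P) : G.HasCompellingColoring P n := by
  let e : α ≃ Fin n := Fintype.equivFinOfCardEq hn
  refine ⟨Coloring.mk (fun v => e (C v)) fun h he => C.valid h (e.injective he), ?_, ?_⟩
  · exact e.surjective.comp hC
  · intro S hS
    refine hP S fun c => ?_
    obtain ⟨v, ⟨hv, hvc⟩, huniq⟩ := hS (e c)
    exact ⟨v, ⟨hv, e.injective hvc⟩, fun w hw => huniq w ⟨hw.1, congrArg e hw.2⟩⟩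

/-- A 2-coloring outside `D` can be chosen to use both colors if there are at least two vertices
outside `D`. -/
theorem exists_bool_coloring_surjective {V : Type*} {G : SimpleGraph V} {D : Set V}
    (f : V → Bool) (hf : ∀ a b, a ∉ D → b ∉ D → G.Adj a b → f a ≠ f b) (hD : Dᶜ.Nontrivial) :
    ∃ g : V → Bool, (∀ a b, a ∉ D → b ∉ D → G.Adj a b → g a ≠ g b) ∧
      ∀ c, ∃ v, v ∉ D ∧ g v = c := by
  classical
  obtain ⟨x, hx, y, hy, hxy⟩ := hD
  by_cases h : ∃ a b, a ∉ D ∧ b ∉ D ∧ f a ≠ f b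
  · obtain ⟨a, b, ha, hb, hab⟩ := h
    refine ⟨f, hf, fun c => ?_⟩
    by_cases hc : f a = c
    · exact ⟨a, ha, hc⟩
    · exact ⟨b, hb, by revert hab hc; cases f a <;> cases f b <;> cases c <;> simp⟩
  · -- A constant `f` forces `Dᶜ` to be independent, so that any function is proper on it.
    push Not at h
    refine ⟨fun v => decide (v = x), fun a b ha hb hab => absurd (h a b ha hb) (hf a b ha hb hab),
      fun c => ?_⟩
    cases c
    · exact ⟨y, hy, by simpa using hxy.symm⟩
    · exact ⟨x, hx, by simp⟩

/-- Color the vertices of a connected dominating set `D` with distinct colors and all other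
vertices with two more colors: every committee contains `D`. -/
theorem hasCompellingColoring_of_bool_coloring {V : Type*} [Finite V] {G : SimpleGraph V}
    {D : Set V} (hc : G.InducesConnected D) (hd : G.IsDominating D) (hD : Dᶜ.Nontrivial)
    (f : V → Bool) (hf : ∀ a b, a ∉ D → b ∉ D → G.Adj a b → f a ≠ f b) :
    G.HasCompellingColoring G.InducesConnected (D.ncard + 2) := by
  classical
  obtain ⟨g, hg, hsurj⟩ := exists_bool_coloring_surjective f hf hD
  have := Fintype.ofFinite D
  let C : V → D ⊕ Bool := fun v => if h : v ∈ D then Sum.inl ⟨v, h⟩ else Sum.inr (g v)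
  have hCin : ∀ v (h : v ∈ D), C v = Sum.inl ⟨v, h⟩ := fun v h => dif_pos h
  have hCout : ∀ v, v ∉ D → C v = Sum.inr (g v) := fun v h => dif_neg h
  have hvalid : ∀ {a b : V}, G.Adj a b → C a ≠ C b := by
    intro a b hab h
    by_cases ha : a ∈ D <;> by_cases hb : b ∈ D
    · rw [hCin a ha, hCin b hb] at h
      exact hab.ne (congrArg Subtype.val (Sum.inl.inj h))
    · rw [hCin a ha, hCout b hb] at h
      exact Sum.inl_ne_inr h
    · rw [hCout a ha, hCin b hb] at h
      exact Sum.inr_ne_inl h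
    · rw [hCout a ha, hCout b hb] at h
      exact hg a b ha hb hab (Sum.inr.inj h)
  refine hasCompellingColoring_of_fintype (α := D ⊕ Bool) ?_ (Coloring.mk C hvalid) ?_ ?_
  · rw [Fintype.card_sum, Fintype.card_bool, ← Nat.card_eq_fintype_card, Nat.card_coe_set_eq]
  · rintro (⟨d, hd⟩ | c)
    · exact ⟨d, hCin d hd⟩
    · obtain ⟨v, hv, rfl⟩ := hsurj c
      exact ⟨v, hCout v hv⟩
  · intro S hS
    refine hc.superset hd fun d hdD => ?_
    obtain ⟨v, ⟨hvS, hv⟩, -⟩ := hS (Sum.inl ⟨d, hdD⟩)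
    change C v = _ at hv
    by_cases hvD : v ∈ D
    · rw [hCin v hvD] at hv
      have e : v = d := congrArg Subtype.val (Sum.inl.inj hv)
      exact e ▸ hvS
    · rw [hCout v hvD] at hv
      exact absurd hv Sum.inr_ne_inl

section Polygon

variable {n : ℕ} {T : SimpleGraph (Fin n)}

/-- A connected set missing the triangle `a b c` lies on the outer side of one of its sides, and
then does not dominate the opposite vertex. -/
theorem IsNoncrossing.triangle_meets_of_dominating (hT : T.IsNoncrossing) {D : Set (Fin n)}
    (hc : T.InducesConnected D) (hd : T.IsDominating D) {a b c : Fin n} (hab : a < b)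
    (hbc : b < c) (h1 : T.Adj a b) (h2 : T.Adj b c) (h3 : T.Adj a c) :
    a ∈ D ∨ b ∈ D ∨ c ∈ D := by
  by_contra! hno
  obtain ⟨ha, hb, hcD⟩ := hno
  obtain ⟨x, hx, hax⟩ := hd a ha
  obtain ⟨y, hy, hby⟩ := hd b hb
  obtain ⟨z, hz, hcz⟩ := hd c hcD
  have hya : y ≠ a := fun h => ha (h ▸ hy)
  have hyc : y ≠ c := fun h => hcD (h ▸ hy)
  have hyb : y ≠ b := hby.ne'
  rcases lt_or_gt_of_ne hya with hya | hya
  · exact hT y a b c hya hab hbc ⟨hby.symm, h3⟩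
  rcases lt_or_gt_of_ne hyc with hyc | hyc
  · rcases lt_or_gt_of_ne hyb with hyb | hyb
    · obtain ⟨h4, h5⟩ := hT.between_of_inducesConnected h1 hc ha hb hy hz hya hyb
      exact hT a z b c h4 h5 hbc ⟨h1, hcz.symm⟩
    · obtain ⟨h4, h5⟩ := hT.between_of_inducesConnected h2 hc hb hcD hy hx hyb hyc
      exact hT a b x c hab h4 h5 ⟨hax, h2⟩
  · exact hT a b c y hab hbc hyc ⟨h3, hby⟩

/-- The vertices outside a set meeting all triangles induce a bipartite graph. -/
theorem IsPolygonTriangulation.exists_bool_coloring (hT : T.IsPolygonTriangulation)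
    {D : Set (Fin n)}
    (hD : ∀ i m j, i < m → m < j → T.Adj i m → T.Adj m j → T.Adj i j → i ∈ D ∨ m ∈ D ∨ j ∈ D)
    (hn : 3 ≤ n) :
    ∃ f : Fin n → Bool, ∀ a b, a ∉ D → b ∉ D → T.Adj a b → f a ≠ f b := by
  have key : ∀ i j : Fin n, i < j → T.Adj i j → ∃ f : Fin n → Bool,
      ∀ a b, i ≤ a → a < b → b ≤ j → a ∉ D → b ∉ D → T.Adj a b → f a ≠ f b := by
    intro i j hij hadj
    refine hT.arc_induction (P := fun i j => ∃ f : Fin n → Bool,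
      ∀ a b, i ≤ a → a < b → b ≤ j → a ∉ D → b ∉ D → T.Adj a b → f a ≠ f b) ?_ ?_ hij hadj
    · intro i j _ hj
      refine ⟨fun v => decide (v = i), fun a b hia hab hbj _ _ _ => ?_⟩
      rw [Fin.le_def] at hia hbj
      rw [Fin.lt_def] at hab
      have e1 : a = i := Fin.ext (by omega)
      have e2 : b ≠ i := fun h => by rw [Fin.ext_iff] at h; omega
      simp [e1, e2]
    · rintro i m j him hmj h1 h2 h3 ⟨f, hf⟩ ⟨g, hg⟩
      -- Negate `g` if needed: to agree with `f` at `m` when `m` is to be colored, and otherwise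
      -- to color the ends of the edge `i j` differently.
      obtain ⟨g, hg, hgm, hgj⟩ : ∃ g : Fin n → Bool,
          (∀ a b, m ≤ a → a < b → b ≤ j → a ∉ D → b ∉ D → T.Adj a b → g a ≠ g b) ∧
          (m ∉ D → g m = f m) ∧ (m ∈ D → g j ≠ f i) := by
        have hneg : ∀ a b, m ≤ a → a < b → b ≤ j → a ∉ D → b ∉ D → T.Adj a b →
            (!g a) ≠ (!g b) := fun a b k1 k2 k3 k4 k5 k6 h =>
          hg a b k1 k2 k3 k4 k5 k6 (Bool.not_inj h)
        by_cases hm : m ∈ D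
        · by_cases hgj : g j = f i
          · exact ⟨fun v => !g v, hneg, fun h => absurd hm h, fun _ => by simp [hgj]⟩
          · exact ⟨g, hg, fun h => absurd hm h, fun _ => hgj⟩
        · by_cases hgm : g m = f m
          · exact ⟨g, hg, fun _ => hgm, fun h => absurd h hm⟩
          · refine ⟨fun v => !g v, hneg, fun _ => ?_, fun h => absurd h hm⟩
            change (!g m) = f m
            revert hgm
            cases g m <;> cases f m <;> simp
      refine ⟨fun v => if v ≤ m then f v else g v, fun a b hia hab hbj ha hb hadj => ?_⟩
      by_cases hbm : b ≤ m
      · have ham : a ≤ m := hab.le.trans hbm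
        simpa only [if_pos ham, if_pos hbm] using hf a b hia hab hbm ha hb hadj
      · have hmb : m < b := not_le.1 hbm
        by_cases ham : a ≤ m
        · simp only [if_pos ham, if_neg hbm]
          rcases ham.eq_or_lt with rfl | ham
          · rw [← hgm ha]
            exact hg a b le_rfl hab hbj ha hb hadj
          · -- The only edge between the two open subarcs is `i j`.
            rcases hia.eq_or_lt with rfl | hia
            · rcases hbj.eq_or_lt with rfl | hbj
              · exact (hgj ((hD i m b him hmj h1 h2 h3).resolve_left ha |>.resolve_right hb)).symm
              · exact absurd ⟨hadj, h2⟩ (hT.prop.2 i m b j him hmb hbj)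
            · exact absurd ⟨h1, hadj⟩ (hT.prop.2 i a m b hia ham hmb)
        · simp only [if_neg ham, if_neg hbm]
          exact hg a b (not_le.1 ham).le hab hbj ha hb hadj
  have hlt : (⟨0, by omega⟩ : Fin n) < ⟨n - 1, by omega⟩ := Fin.lt_def.2 (by simp; omega)
  have h0 : ∀ v : Fin n, (⟨0, by omega⟩ : Fin n) ≤ v := fun v => Fin.le_def.2 (by simp)
  have h1 : ∀ v : Fin n, v ≤ (⟨n - 1, by omega⟩ : Fin n) := fun v => by
    have := v.isLt
    exact Fin.le_def.2 (by simp; omega)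
  obtain ⟨f, hf⟩ := key _ _ hlt (hT.adj_first_last hlt rfl (by simp; omega))
  refine ⟨f, fun a b ha hb hab => ?_⟩
  rcases lt_or_gt_of_ne hab.ne with hlt | hlt
  · exact hf a b (h0 _) hlt (h1 _) ha hb hab
  · exact (hf b a (h0 _) hlt (h1 _) hb ha hab.symm).symm

theorem IsPolygonTriangulation.hasCompellingColoring (hT : T.IsPolygonTriangulation) (hn : 3 ≤ n)
    {D : Set (Fin n)} (hc : T.InducesConnected D) (hd : T.IsDominating D)
    (hcard : D.encard + 2 ≤ n) :
    T.HasCompellingColoring T.InducesConnected (D.ncard + 2) := by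
  obtain ⟨f, hf⟩ := hT.exists_bool_coloring (D := D)
    (fun i m j => hT.prop.2.triangle_meets_of_dominating hc hd) hn
  refine hasCompellingColoring_of_bool_coloring hc hd ?_ f hf
  have h := Set.encard_add_encard_compl D
  rw [Set.encard_univ, ENat.card_eq_coe_fintype_card, Fintype.card_fin] at h
  rw [← Set.one_lt_encard_iff_nontrivial]
  rw [← h, ENat.add_le_add_iff_left D.toFinite.encard_lt_top.ne] at hcard
  exact lt_of_lt_of_le (by norm_num) hcard

/-! ### From colorings to connected dominating sets -/

/-- A choice of one vertex of each color is a rainbow committee. -/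
theorem Coloring.Compels.range {V α : Type*} {G : SimpleGraph V} {C : G.Coloring α}
    {P : Set V → Prop} (hC : C.Compels P) {s : α → V} (hs : ∀ c, C (s c) = c) :
    P (Set.range s) := by
  refine hC _ fun c => ⟨s c, ⟨⟨c, rfl⟩, hs c⟩, ?_⟩
  rintro _ ⟨⟨c', rfl⟩, h⟩
  rw [hs] at h
  rw [h]

/-- In a coloring compelling connectivity, the vertices that are alone in their color class cover
the chords: if both ends of a chord could be avoided, a committee avoiding them would lie on one
side of it, and swapping in a vertex of the other side would disconnect the committee. -/
theorem IsPolygonTriangulation.coversChords_of_compels (hT : T.IsPolygonTriangulation)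
    {α : Type*} {C : T.Coloring α} (hsurj : Function.Surjective C)
    (hC : C.Compels T.InducesConnected) : T.CoversChords {v | ∀ w, C w = C v → w = v} := by
  classical
  refine coversChords_of_lt fun p q hpq hadj hside => ?_
  by_contra! hno
  obtain ⟨hp, hq⟩ := hno
  simp only [Set.mem_ofPred_eq, not_forall] at hp hq
  obtain ⟨p', hp', hpp⟩ := hp
  obtain ⟨q', hq', hqq⟩ := hq
  have hCpq : C p ≠ C q := C.valid hadj
  have hchoice : ∀ c, ∃ v, C v = c ∧ v ≠ p ∧ v ≠ q := by
    intro c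
    obtain ⟨v, rfl⟩ := hsurj c
    by_cases h1 : v = p
    · subst h1
      exact ⟨p', hp', hpp, fun h => hCpq (by rw [← hp', h])⟩
    by_cases h2 : v = q
    · subst h2
      exact ⟨q', hq', fun h => hCpq (by rw [← hq', h]), hqq⟩
    exact ⟨v, rfl, h1, h2⟩
  choose s hs hsp hsq using hchoice
  -- A committee avoiding `p` and `q` with a vertex in between has all its vertices in between.
  have hsep : ∀ t : α → Fin n, (∀ c, C (t c) = c) → (∀ c, t c ≠ p) → (∀ c, t c ≠ q) →
      ∀ c c', p < t c → t c < q → p < t c' ∧ t c' < q := by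
    intro t ht htp htq c c' h1 h2
    exact hT.prop.2.between_of_inducesConnected hadj (hC.range ht)
      (fun ⟨c, h⟩ => htp c h) (fun ⟨c, h⟩ => htq c h) ⟨c, rfl⟩ ⟨c', rfl⟩ h1 h2
  have hswap : ∀ r, r ≠ p → r ≠ q → ∀ c c',
      p < Function.update s (C r) r c → Function.update s (C r) r c < q →
      p < Function.update s (C r) r c' ∧ Function.update s (C r) r c' < q := by
    intro r hrp hrq
    refine hsep _ ?_ ?_ ?_ <;> intro c <;> by_cases h : c = C r
    · subst h; simp
    · simp [h, hs]
    · subst h; simpa using hrp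
    · simpa [h] using hsp c
    · subst h; simpa using hrq
    · simpa [h] using hsq c
  have hother : ∀ c : α, ∃ c', c' ≠ c := fun c => by
    by_cases h : C p = c
    · exact ⟨C q, fun h' => hCpq (h.trans h'.symm)⟩
    · exact ⟨C p, h⟩
  rw [cycleGraph_adj_iff_of_lt hpq] at hside
  have hpq' := Fin.lt_def.1 hpq
  have hqlt := q.isLt
  by_cases h : p < s (C p) ∧ s (C p) < q
  · obtain ⟨r, hr⟩ : ∃ r : Fin n, r < p ∨ q < r := by
      by_cases h0 : (p : ℕ) = 0
      · exact ⟨⟨n - 1, by omega⟩, Or.inr (Fin.lt_def.2 (by simp; omega))⟩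
      · exact ⟨⟨0, by omega⟩, Or.inl (Fin.lt_def.2 (by simp; omega))⟩
    have hrp : r ≠ p := by rintro rfl; exact hr.elim (lt_irrefl _) hpq.asymm
    have hrq : r ≠ q := by rintro rfl; exact hr.elim hpq.asymm (lt_irrefl _)
    obtain ⟨c', hc'⟩ := hother (C r)
    have h1 := hsep s hs hsp hsq _ c' h.1 h.2
    have h2 := hswap r hrp hrq c' (C r) (by simpa [hc'] using h1.1) (by simpa [hc'] using h1.2)
    rw [Function.update_self] at h2
    exact hr.elim h2.1.asymm h2.2.asymm
  · let r : Fin n := ⟨p + 1, by omega⟩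
    have hpr : p < r := Fin.lt_def.2 (by simp [r])
    have hrq : r < q := Fin.lt_def.2 (by simp only [r]; omega)
    obtain ⟨c', hc'⟩ := hother (C r)
    have h2 := hswap r hpr.ne' hrq.ne (C r) c' (by simpa using hpr) (by simpa using hrq)
    rw [Function.update_of_ne hc'] at h2
    exact h (hsep s hs hsp hsq _ _ h2.1 h2.2)

/-- Some vertex outside an independent set `A` has no chord to `A`: in the arc under a shortest
chord `p q` with `p ∈ A` and `q ∉ A`, the neighbor of `p` along the polygon is such a vertex. -/
theorem IsPolygonTriangulation.exists_notMem_forall_side (hT : T.IsPolygonTriangulation)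
    (hn : 2 ≤ n) {A : Set (Fin n)} (hA : ∀ a ∈ A, ∀ b ∈ A, ¬ T.Adj a b) :
    ∃ u ∉ A, ∀ a ∈ A, T.Adj u a → (cycleGraph n).Adj u a := by
  by_contra! hno
  have key : ∀ (k : ℕ) (p q : Fin n), p ∈ A → q ∉ A → T.Adj p q →
      ¬ (cycleGraph n).Adj p q → (q : ℕ) - p + (p - q) = k → False := by
    intro k
    induction k using Nat.strong_induction_on with
    | _ k ih =>
      intro p q hp hq hadj hside hk
      have hplt := p.isLt
      have hqlt := q.isLt
      rcases lt_or_gt_of_ne hadj.ne with hpq | hqp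
      · rw [cycleGraph_adj_iff_of_lt hpq] at hside
        have hpq' := Fin.lt_def.1 hpq
        let r : Fin n := ⟨p + 1, by omega⟩
        have hrv : (r : ℕ) = p + 1 := rfl
        have hr : r ∉ A := fun h => hA p hp r h (hT.adj_of_val_eq_succ hrv)
        obtain ⟨a, ha, hra, hside'⟩ := hno r hr
        have hap : a ≠ p := by
          rintro rfl
          exact hside' ((cycleGraph_adj_iff_of_lt (Fin.lt_def.2 (by omega))).2 (Or.inl hrv)).symm
        have haq : a ≠ q := fun h => hq (h ▸ ha)
        have hpr : p < r := Fin.lt_def.2 (by omega)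
        have hrq : r < q := Fin.lt_def.2 (by omega)
        have h1 : p < a := by
          by_contra h
          exact hT.prop.2 a p r q (lt_of_le_of_ne (not_lt.1 h) hap) hpr hrq ⟨hra.symm, hadj⟩
        have h2 : a < q := by
          by_contra h
          exact hT.prop.2 p r q a hpr hrq (lt_of_le_of_ne (not_lt.1 h) haq.symm) ⟨hadj, hra⟩
        rw [Fin.lt_def] at h1 h2
        exact ih _ (by omega) a r ha hr hra.symm (fun h => hside' h.symm) rfl
      · rw [SimpleGraph.adj_comm, cycleGraph_adj_iff_of_lt hqp] at hside
        have hqp' := Fin.lt_def.1 hqp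
        let r : Fin n := ⟨p - 1, by omega⟩
        have hrv : (p : ℕ) = r + 1 := by simp only [r]; omega
        have hr : r ∉ A := fun h => hA r h p hp (hT.adj_of_val_eq_succ hrv)
        obtain ⟨a, ha, hra, hside'⟩ := hno r hr
        have hap : a ≠ p := by
          rintro rfl
          exact hside' ((cycleGraph_adj_iff_of_lt (Fin.lt_def.2 (by omega))).2 (Or.inl hrv))
        have haq : a ≠ q := fun h => hq (h ▸ ha)
        have hrp : r < p := Fin.lt_def.2 (by omega)
        have hqr : q < r := Fin.lt_def.2 (by omega)
        have h1 : a < p := by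
          by_contra h
          exact hT.prop.2 q r p a hqr hrp (lt_of_le_of_ne (not_lt.1 h) hap.symm)
            ⟨hadj.symm, hra⟩
        have h2 : q < a := by
          by_contra h
          exact hT.prop.2 a q r p (lt_of_le_of_ne (not_lt.1 h) haq) hqr hrp
            ⟨hra.symm, hadj.symm⟩
        rw [Fin.lt_def] at h1 h2
        exact ih _ (by omega) a r ha hr hra.symm (fun h => hside' h.symm) rfl
  obtain ⟨u, hu⟩ : ∃ u, u ∉ A := by
    by_contra! h
    exact hA _ (h ⟨0, by omega⟩) _ (h ⟨1, by omega⟩) (hT.adj_of_val_eq_succ rfl)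
  obtain ⟨a, ha, hua, hside⟩ := hno u hu
  exact key _ a u ha hu hua.symm (fun h => hside h.symm) rfl

theorem encard_add_two_le_of_injOn {V : Type*} {k : ℕ} {f : V → Fin k} {D : Set V}
    (hinj : Set.InjOn f D) {c c' : Fin k} (hcc : c ≠ c') (hc : ∀ v ∈ D, f v ≠ c)
    (hc' : ∀ v ∈ D, f v ≠ c') : D.encard + 2 ≤ k := by
  have hdisj : Disjoint (f '' D) {c, c'} := by
    rw [Set.disjoint_right]
    rintro x (rfl | rfl) ⟨v, hv, h⟩
    exacts [hc v hv h, hc' v hv h]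
  rw [← hinj.encard_image, ← Set.encard_pair hcc, ← Set.encard_union_eq hdisj]
  refine (Set.encard_le_encard (Set.subset_univ _)).trans ?_
  rw [Set.encard_univ, ENat.card_eq_coe_fintype_card, Fintype.card_fin]

/-- The vertices alone in their color class, with one vertex dropped when exactly one color class
has several vertices, form a connected dominating set; if all vertices are alone, there are `n`
colors and the complement of a side is small enough. -/
theorem IsPolygonTriangulation.exists_dominating_of_hasCompellingColoring
    (hT : T.IsPolygonTriangulation) (hn : 3 ≤ n) {k : ℕ}
    (h : T.HasCompellingColoring T.InducesConnected k) :
    ∃ D : Set (Fin n), T.IsDominating D ∧ T.InducesConnected D ∧ D.encard + 2 ≤ k := by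
  obtain ⟨C, hsurj, hC⟩ := h
  by_cases hinj : Function.Injective C
  · obtain ⟨D, h1, h2, h3⟩ := hT.exists_connected_dominating_encard hn
    have := Fintype.card_le_of_injective C hinj
    rw [Fintype.card_fin, Fintype.card_fin] at this
    exact ⟨D, h1, h2, h3.trans (by exact_mod_cast this)⟩
  obtain ⟨x, y, hxy, hne⟩ : ∃ x y, C x = C y ∧ x < y := by
    simp only [Function.Injective, not_forall] at hinj
    obtain ⟨x, y, hxy, hne⟩ := hinj
    rcases lt_or_gt_of_ne hne with h | h
    exacts [⟨x, y, hxy, h⟩, ⟨y, x, hxy.symm, h⟩]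
  have hCadj : ∀ a b, C a = C b → ¬ T.Adj a b := fun a b h hab => C.valid hab h
  set D₀ : Set (Fin n) := {v | ∀ w, C w = C v → w = v} with hD₀
  have hcov : T.CoversChords D₀ := hT.coversChords_of_compels hsurj hC
  have hinjD : Set.InjOn C D₀ := fun a _ b hb hab => hb a hab
  have hnot : ∀ v, v ∉ D₀ → ∀ w ∈ D₀, C w ≠ C v := fun v hv w hw h =>
    hv ((hw v h.symm) ▸ hw)
  have hxD : x ∉ D₀ := fun h => hne.ne' (h y hxy.symm)
  have hchord : ∃ p q, T.Adj p q ∧ ¬ (cycleGraph n).Adj p q := by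
    -- An edge that crosses the missing edge `x y` is a chord.
    obtain ⟨c, d, hcd, hxc, hcy, hd⟩ := hT.exists_crossing hne (hCadj x y hxy)
    rw [Fin.lt_def] at hxc hcy
    have hylt := y.isLt
    rcases hd with hd | hd <;> have hd' := Fin.lt_def.1 hd
    · refine ⟨d, c, hcd.symm, ?_⟩
      rw [cycleGraph_adj_iff_of_lt (Fin.lt_def.2 (by omega))]
      omega
    · refine ⟨c, d, hcd, ?_⟩
      rw [cycleGraph_adj_iff_of_lt (Fin.lt_def.2 (by omega))]
      omega
  have hcovne : ∀ {D : Set (Fin n)}, T.CoversChords D → D.Nonempty := fun hD => by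
    obtain ⟨p, q, h1, h2⟩ := hchord
    exact (hD p q h1 h2).elim (fun h => ⟨p, h⟩) fun h => ⟨q, h⟩
  by_cases htwo : ∃ a, a ∉ D₀ ∧ C a ≠ C x
  · obtain ⟨a, ha, hax⟩ := htwo
    exact ⟨D₀, hcov.isDominating hT hn (hcovne hcov), hcov.inducesConnected hT hn (hcovne hcov),
      encard_add_two_le_of_injOn hinjD hax (hnot a ha) (hnot x hxD)⟩
  push Not at htwo
  -- A single color is used more than once; a vertex without a chord to its class can be dropped.
  obtain ⟨u, hu, hside⟩ := hT.exists_notMem_forall_side (by omega) (A := D₀ᶜ)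
    fun a ha b hb => hCadj a b ((htwo a ha).trans (htwo b hb).symm)
  rw [Set.mem_compl_iff, not_not] at hu
  have hcov' : T.CoversChords (D₀ \ {u}) := by
    intro p q hadj hpq
    by_cases hpu : p = u
    · subst hpu
      refine Or.inr ⟨?_, hadj.ne'⟩
      by_contra hq
      exact hpq (hside q hq hadj)
    by_cases hqu : q = u
    · subst hqu
      refine Or.inl ⟨?_, hadj.ne⟩
      by_contra hp
      exact hpq (hside p hp hadj.symm).symm
    exact (hcov p q hadj hpq).imp (fun h => ⟨h, hpu⟩) fun h => ⟨h, hqu⟩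
  exact ⟨D₀ \ {u}, hcov'.isDominating hT hn (hcovne hcov'),
    hcov'.inducesConnected hT hn (hcovne hcov'),
    encard_add_two_le_of_injOn (hinjD.mono Set.sdiff_subset) (hnot x hxD u hu)
      (fun v hv h => hv.2 (hinjD hv.1 hu h)) (fun v hv => hnot x hxD v hv.1)⟩

end Polygon

/-! ### Invariance under isomorphism -/

section Iso

variable {V W : Type*} {G : SimpleGraph V} {H : SimpleGraph W}

theorem InducesConnected.image (e : G ≃g H) {S : Set V} (hS : G.InducesConnected S) :
    H.InducesConnected (e '' S) := by
  let f : G.induce S ≃g H.induce (e '' S) :=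
    { toEquiv := e.toEquiv.image S
      map_rel_iff' := e.map_rel_iff' }
  exact f.connected_iff.1 hS

theorem IsDominating.image (e : G ≃g H) {D : Set V} (hD : G.IsDominating D) :
    H.IsDominating (e '' D) := by
  intro w hw
  obtain ⟨v, rfl⟩ := e.surjective w
  obtain ⟨u, hu, hadj⟩ := hD v fun h => hw ⟨v, h, rfl⟩
  exact ⟨e u, ⟨u, hu, rfl⟩, e.map_adj_iff.2 hadj⟩

theorem HasCompellingColoring.of_iso (e : G ≃g H) {k : ℕ}
    (h : G.HasCompellingColoring G.InducesConnected k) :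
    H.HasCompellingColoring H.InducesConnected k := by
  obtain ⟨C, hsurj, hC⟩ := h
  refine ⟨Coloring.mk (fun w => C (e.symm w)) fun hab => C.valid (e.symm.map_adj_iff.2 hab),
    hsurj.comp e.symm.surjective, fun S hS => ?_⟩
  have key : G.InducesConnected (e.symm '' S) := by
    refine hC _ fun c => ?_
    obtain ⟨w, ⟨hw, hwc⟩, huniq⟩ := hS c
    refine ⟨e.symm w, ⟨⟨w, hw, rfl⟩, hwc⟩, ?_⟩
    rintro _ ⟨⟨w', hw', rfl⟩, h⟩
    exact congrArg e.symm (huniq w' ⟨hw', h⟩)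
  have := key.image e
  rwa [Set.image_image, Set.image_congr fun a _ => e.apply_symm_apply a, Set.image_id'] at this

end Iso

end SimpleGraph

theorem theoremt {V : Type*} [Fintype V] (G : SimpleGraph V) (hG : G.IsMOP)
    (hV : 3 ≤ Fintype.card V) :
    G.compellingChromaticNumber G.InducesConnected ≠ ⊤ ∧
      G.compellingChromaticNumber G.InducesConnected = G.connectedDominationNumber + 2 := by
  obtain ⟨n, T, hT, ⟨e⟩⟩ := hG
  have hn : 3 ≤ n := by
    rwa [Fintype.card_congr e.toEquiv, Fintype.card_fin] at hV
  have hle : ∀ {k : ℕ}, G.HasCompellingColoring G.InducesConnected k →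
      G.compellingChromaticNumber G.InducesConnected ≤ k := fun h => iInf₂_le _ h
  have hupper : ∀ D : Set (Fin n), T.IsDominating D → T.InducesConnected D → D.encard + 2 ≤ n →
      G.compellingChromaticNumber G.InducesConnected ≤ D.encard + 2 := by
    intro D hd hc hcard
    refine (hle ((hT.hasCompellingColoring hn hc hd hcard).of_iso e.symm)).trans ?_
    rw [Nat.cast_add, D.toFinite.cast_ncard_eq]
    rfl
  obtain ⟨P, hPd, hPc, hPn⟩ := hT.exists_connected_dominating_encard hn
  have hfin : G.compellingChromaticNumber G.InducesConnected ≤ n :=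
    (hupper P hPd hPc hPn).trans hPn
  refine ⟨ne_top_of_le_ne_top (ENat.natCast_ne_top n) hfin, le_antisymm ?_ ?_⟩
  · have : Nonempty {D : Set V // G.IsDominating D ∧ G.InducesConnected D} :=
      ⟨⟨_, hPd.image e.symm, hPc.image e.symm⟩⟩
    obtain ⟨⟨D, hd, hc⟩, hD⟩ := ENat.exists_eq_iInf
      fun D : {D : Set V // G.IsDominating D ∧ G.InducesConnected D} => D.1.encard
    have hmin : G.connectedDominationNumber = D.encard := by
      rw [hD, SimpleGraph.connectedDominationNumber, iInf_subtype]
      rfl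
    rw [hmin, ← e.injective.encard_image]
    rcases le_total ((e '' D).encard + 2) n with h | h
    · exact hupper _ (hd.image e) (hc.image e) h
    · exact hfin.trans h
  · refine le_iInf₂ fun k hk => ?_
    obtain ⟨D, hd, hc, hcard⟩ :=
      hT.exists_dominating_of_hasCompellingColoring hn (SimpleGraph.HasCompellingColoring.of_iso e hk)
    refine le_trans (add_le_add_left ?_ 2) hcard
    rw [← e.symm.injective.encard_image]
    exact iInf₂_le (e.symm '' D) ⟨hd.image e.symm, hc.image e.symm⟩
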